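/- Let $(\alpha_i)_{i\ge 0}$ be real numbers with $\alpha_i\in[0,1]$, $\max_{i\ge 0}\alpha_i=1$ and $\alpha_i=O(i^{-\theta})$ as $i\to\infty$ for some $\theta>1$. Let $(\epsilon_t)_{t\in\mathbb Z}$ be i.i.d. real random variables with $P(\epsilon_0>0)>0$ and $E(|\epsilon_0|^{1+\delta})<\infty$ for some $\delta>0$, and let $(\eta_t)_{t\in\mathbb Z}$ be i.i.d. real random variables, independent of $(\epsilon_t)_{t\in\mathbb Z}$, with $E(\eta_0^2)<\infty$ and $P(\eta_0>z)\sim K z^{\beta}e^{-z}$ as $z\to\infty$, for some real $\beta\ne -1$ and some $K>0$. Consider the equations $$X_t=\sigma_t\epsilon_t,\qquad \log(\sigma_t)=\sum_{i=0}^\infty \alpha_i\eta_{t-i},\qquad t\in\mathbb Z,\tag{1}$$ with $\sigma_t>0$, to hold almost surely. For all laws of $\epsilon_0$ and $\eta_0$ as above there is a probability space carrying such sequences $(\epsilon_t)$, $(\eta_t)$ and a strictly stationary solution $(X_t,\sigma_t)_{t\in\mathbb Z}$ of (1). Moreover, for any such sequences $(\epsilon_t)$, $(\eta_t)$ on any probability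 space, (1) has a solution, and every solution $(X_t,\sigma_t)_{t\in\mathbb Z}$ is strictly stationary and has the following properties. The distributions of $|X_0|$ and of $\sigma_0$ are regularly varying with index $-1$, that is, for $Z=|X_0|$ and for $Z=\sigma_0$ one has $P(Z>x)>0$ for all large $x$ and $\lim_{x\to\infty}P(Z>sx)/P(Z>x)=s^{-1}$ for every $s>0$. The distribution of $X_0$ is tail balanced with $$\lim_{x\to\infty}\frac{P(X_0>x)}{P(|X_0|>x)}=\frac{E(\epsilon_0^+)}{E(|\epsilon_0|)},\qquad \lim_{x\to\infty}\frac{P(X_0<-x)}{P(|X_0|>x)}=\frac{E(\epsilon_0^-)}{E(|\epsilon_0|)},$$ where $y^+=\max\{y,0\}$ and $y^-=\max\{-y,0\}$, and $$\lim_{x\to\infty}\frac{P(|X_0|>x)}{P(\sigma_0>x)}=E(|\epsilon_0|),\qquad \lim_{x\to\infty}\frac{P(X_0>x)}{P(\sigma_0>x)}=E(\epsilon_0^+).$$ -/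

import Mathlib

open MeasureTheory ProbabilityTheory Filter Topology

universe u

/-- The coefficients of the moving average: `α i ∈ [0,1]`, `max_i α i = 1`, and
`α i = O(i^{-θ})` for some `θ > 1`. -/
structure IsSVCoefficient (α : ℕ → ℝ) : Prop where
  mem_Icc : ∀ i, α i ∈ Set.Icc (0 : ℝ) 1
  max_eq_one : IsGreatest (Set.range α) 1
  isBigO : ∃ θ : ℝ, 1 < θ ∧ α =O[atTop] fun i : ℕ => (i : ℝ) ^ (-θ)

/-- The law of the return innovations: `P(ε₀ > 0) > 0` and `E|ε₀|^{1+δ} < ∞` for some `δ > 0`. -/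
structure IsReturnInnovationLaw (μ : Measure ℝ) : Prop where
  pos : 0 < μ (Set.Ioi 0)
  moment : ∃ δ : ℝ, 0 < δ ∧ Integrable (fun x : ℝ => |x| ^ (1 + δ)) μ

/-- The law of the log-volatility innovations: `E(η₀²) < ∞` and
`P(η₀ > z) ∼ K z^β e^{-z}` as `z → ∞`, for constants `β ≠ -1` and `K > 0`. -/
structure IsGammaTypeLaw (μ : Measure ℝ) : Prop where
  sq_integrable : Integrable (fun x : ℝ => x ^ 2) μ
  tail : ∃ β K : ℝ, β ≠ -1 ∧ 0 < K ∧
    Asymptotics.IsEquivalent atTop (fun z : ℝ => μ.real (Set.Ioi z))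
      (fun z : ℝ => K * z ^ β * Real.exp (-z))

/-- `(ε t)` is i.i.d. with law `με`, `(η t)` is i.i.d. with law `μη`, and the two sequences are
independent of each other. -/
structure IsInnovationPair {Ω : Type*} [MeasurableSpace Ω] (P : Measure Ω)
    (με μη : Measure ℝ) (ε η : ℤ → Ω → ℝ) : Prop where
  measurable_ε : ∀ t, Measurable (ε t)
  measurable_η : ∀ t, Measurable (η t)
  indep_ε : iIndepFun ε P
  indep_η : iIndepFun η P
  law_ε : ∀ t, P.map (ε t) = με
  law_η : ∀ t, P.map (η t) = μη
  indep : IndepFun (fun ω t => ε t ω) (fun ω t => η t ω) P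

/-- `(X t, σ t)` solves, almost surely for all `t ∈ ℤ`, the equations `X t = σ t * ε t` and
`log (σ t) = ∑_{i ≥ 0} α i * η (t - i)` (a convergent series), with positive `σ t`. -/
structure IsSVSolution {Ω : Type*} [MeasurableSpace Ω] (P : Measure Ω)
    (α : ℕ → ℝ) (ε η : ℤ → Ω → ℝ) (X σ : ℤ → Ω → ℝ) : Prop where
  measurable_X : ∀ t, Measurable (X t)
  measurable_σ : ∀ t, Measurable (σ t)
  σ_pos : ∀ᵐ ω ∂P, ∀ t, 0 < σ t ω
  log_σ : ∀ᵐ ω ∂P, ∀ t : ℤ,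
    HasSum (fun i : ℕ => α i * η (t - (i : ℤ)) ω) (Real.log (σ t ω))
  X_eq : ∀ᵐ ω ∂P, ∀ t, X t ω = σ t ω * ε t ω

/-- Strict stationarity of a process indexed by `ℤ`: every time shift of the process has the same
law on the path space (with the product σ-algebra). -/
def IsStrictlyStationary {Ω E : Type*} [MeasurableSpace Ω] [MeasurableSpace E] (P : Measure Ω)
    (Z : ℤ → Ω → E) : Prop :=
  ∀ h : ℤ, IdentDistrib (fun ω (t : ℤ) => Z (t + h) ω) (fun ω (t : ℤ) => Z t ω) P P

/-- The distribution of the real random variable `Z` is regularly varying (at `+∞`) with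
index `ρ`: its survival function is eventually positive and
`P(Z > s x) / P(Z > x) → s^ρ` as `x → ∞`, for all `s > 0`. -/
def HasRegularlyVaryingTail {Ω : Type*} [MeasurableSpace Ω] (P : Measure Ω)
    (Z : Ω → ℝ) (ρ : ℝ) : Prop :=
  (∀ᶠ x : ℝ in atTop, 0 < P.real {ω | x < Z ω}) ∧
  ∀ s : ℝ, 0 < s →
    Tendsto (fun x : ℝ => P.real {ω | s * x < Z ω} / P.real {ω | x < Z ω}) atTop (𝓝 (s ^ ρ))

/-! Split the coefficients at the value 1. Since `α i → 0`, only finitely many equal 1 and the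
others are bounded by some `c < 1`, so `log σ 0 = S + V`, where `S` is a finite nonempty sum of
independent copies of the log-volatility innovation and `V` is an independent series with
coefficients at most `c`.

The innovation has a tail with `P(Y > z - u) / P(Y > z) → e^u`. This class is closed under
independent sums (`HasExpTail.add`, the main tail estimate), so it contains `S`, and `exp S` is
regularly varying of index `-1`. The exact tail of `S` is never needed. The factor `exp V` has a
moment of some order `p > 1`, because `p c < 1` is possible and innovations have exponential moments
of every order below 1. Breiman's lemma then makes the tail of `σ 0 = exp S * exp V` a positive
constant times that of `exp S`.

As `σ 0` is independent of `ε 0`, Breiman's lemma applies again to `σ 0 * f (ε 0)` with `f` the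
absolute value, the positive part and the negative part. The limits for `X 0` are these three
constants and their quotients. Stationarity holds because every solution is a.s. one fixed
measurable, shift-equivariant functional of the innovation paths. -/

/-! ### Exponential tails and their stability under independent sums -/

section Tails

open scoped ENNReal

variable {Ω : Type*} [MeasurableSpace Ω] {P : Measure Ω}

/-- The survival function of `Y` is positive and `P(Y > z - u) / P(Y > z) → e^u` for all `u`. -/
structure HasExpTail {Ω : Type*} [MeasurableSpace Ω] (P : Measure Ω) (Y : Ω → ℝ) : Prop where
  pos : ∀ z, 0 < P.real {ω | z < Y ω}
  tendsto : ∀ u : ℝ, Tendsto (fun z => P.real {ω | z - u < Y ω} / P.real {ω | z < Y ω}) atTop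
    (𝓝 (Real.exp u))

theorem antitone_survival [IsFiniteMeasure P] (Y : Ω → ℝ) :
    Antitone fun z => P.real {ω | z < Y ω} :=
  fun _ _ h => measureReal_mono fun _ hω => lt_of_le_of_lt h hω

theorem HasExpTail.eventually_le {Y : Ω → ℝ} [IsFiniteMeasure P] (hY : HasExpTail P Y) {u c : ℝ}
    (hc : Real.exp u < c) : ∀ᶠ z in atTop,
      P {ω | z - u < Y ω} ≤ ENNReal.ofReal c * P {ω | z < Y ω} := by
  have hc0 : 0 ≤ c := (Real.exp_pos u).le.trans hc.le
  filter_upwards [(hY.tendsto u).eventually_lt_const hc] with z hz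
  rw [div_lt_iff₀ (hY.pos z)] at hz
  rw [← ofReal_measureReal (μ := P), ← ofReal_measureReal (μ := P), ← ENNReal.ofReal_mul hc0]
  exact ENNReal.ofReal_le_ofReal hz.le

/-- Upper bounds for all shifts suffice: the lower bound for `u` is the upper bound for `-u`, read
at the point `z - u`. -/
theorem HasExpTail.of_eventually_le {Y : Ω → ℝ} [IsFiniteMeasure P]
    (hpos : ∀ z, 0 < P.real {ω | z < Y ω})
    (h : ∀ u c : ℝ, Real.exp u < c → ∀ᶠ z in atTop,
      P {ω | z - u < Y ω} ≤ ENNReal.ofReal c * P {ω | z < Y ω}) : HasExpTail P Y := by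
  have h' : ∀ u c : ℝ, Real.exp u < c → ∀ᶠ z in atTop,
      P.real {ω | z - u < Y ω} ≤ c * P.real {ω | z < Y ω} := by
    intro u c hc
    have hc0 : 0 ≤ c := (Real.exp_pos u).le.trans hc.le
    filter_upwards [h u c hc] with z hz
    have := ENNReal.toReal_mono (by finiteness) hz
    rwa [ENNReal.toReal_mul, ENNReal.toReal_ofReal hc0] at this
  refine ⟨hpos, fun u => tendsto_order.2 ⟨fun a ha => ?_, fun a ha => ?_⟩⟩
  · by_cases ha0 : 0 < a
    · obtain ⟨b, hab, hb⟩ := exists_between ha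
      have hb0 := ha0.trans hab
      have hlt : Real.exp (-u) < b⁻¹ := by
        rw [Real.exp_neg]; exact inv_strictAnti₀ hb0 hb
      have hev := (tendsto_atTop_add_const_right atTop (-u) tendsto_id).eventually (h' (-u) _ hlt)
      filter_upwards [hev] with z hz
      simp only [id, sub_neg_eq_add, ← sub_eq_add_neg, sub_add_cancel] at hz
      rw [lt_div_iff₀ (hpos z)]
      have : b * P.real {ω | z < Y ω} ≤ P.real {ω | z - u < Y ω} := by
        rwa [← le_inv_mul_iff₀ hb0]
      exact lt_of_lt_of_le (mul_lt_mul_of_pos_right hab (hpos z)) this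
    · exact Eventually.of_forall fun z =>
        lt_of_le_of_lt (not_lt.1 ha0) (div_pos (hpos _) (hpos _))
  · obtain ⟨b, hub, hba⟩ := exists_between ha
    filter_upwards [h' u b hub] with z hz
    exact lt_of_le_of_lt ((div_le_iff₀ (hpos z)).2 hz) hba

theorem ProbabilityTheory.IndepFun.measure_le_mul_of_fiber_right [IsFiniteMeasure P] {X Y : Ω → ℝ}
    (h : IndepFun X Y P) (hX : Measurable X) (hY : Measurable Y) {S S' : Set (ℝ × ℝ)}
    (hS : MeasurableSet S) (hS' : MeasurableSet S') {c : ℝ≥0∞}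
    (hc : c ≠ ∞) (hle : ∀ y, P {ω | (X ω, y) ∈ S'} ≤ c * P {ω | (X ω, y) ∈ S}) :
    P {ω | (X ω, Y ω) ∈ S'} ≤ c * P {ω | (X ω, Y ω) ∈ S} := by
  have key : ∀ A : Set (ℝ × ℝ), MeasurableSet A →
      P {ω | (X ω, Y ω) ∈ A} = ∫⁻ y, P {ω | (X ω, y) ∈ A} ∂(P.map Y) := by
    intro A hA
    have h1 : P {ω | (X ω, Y ω) ∈ A} = P.map (fun ω => (X ω, Y ω)) A :=
      (Measure.map_apply (hX.prodMk hY) hA).symm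
    rw [h1, h.map_prod_eq_prod_map_map hX.aemeasurable hY.aemeasurable,
      Measure.prod_apply_symm hA]
    refine lintegral_congr fun y => ?_
    rw [Measure.map_apply hX (measurable_prodMk_right hA)]
    rfl
  rw [key S hS, key S' hS']
  rw [← lintegral_const_mul' _ _ hc]
  exact lintegral_mono hle

/-- Cut `{X + Y > z - u}` at a level `v` so that on each piece one variable, given the other,
exceeds a large threshold; lowering `z` by `u` then costs at most a factor `d` close to `e^u`. The
resulting pieces of `{X + Y > z}` overlap only in a strip of width `|u|` above `v`. Averaging over
many levels with disjoint strips makes the overlap negligible. -/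
theorem HasExpTail.add [IsProbabilityMeasure P] {X Y : Ω → ℝ} (hXY : IndepFun X Y P)
    (hmX : Measurable X) (hmY : Measurable Y) (hX : HasExpTail P X) (hY : HasExpTail P Y) :
    HasExpTail P (fun ω => X ω + Y ω) := by
  refine HasExpTail.of_eventually_le (fun z => ?_) fun u c huc => ?_
  · have h1 : P {ω | 0 < X ω ∧ z < Y ω} = P {ω | 0 < X ω} * P {ω | z < Y ω} :=
      hXY.measure_inter_preimage_eq_mul _ _ measurableSet_Ioi measurableSet_Ioi
    have h2 : P.real {ω | 0 < X ω ∧ z < Y ω} = P.real {ω | 0 < X ω} * P.real {ω | z < Y ω} := by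
      simp only [Measure.real, h1, ENNReal.toReal_mul]
    refine lt_of_lt_of_le (h2 ▸ mul_pos (hX.pos 0) (hY.pos z)) (measureReal_mono ?_)
    rintro ω ⟨h, h'⟩
    simp only [Set.mem_ofPred_eq]; linarith
  obtain ⟨d, hud, hdc⟩ := exists_between huc
  have hd0 : 0 < d := (Real.exp_pos u).trans hud
  -- With `n` levels the average overlap is at most a fraction `1 / n`, and this `n` gives `d (1 + 1
  -- / n) ≤ c`.
  obtain ⟨n, hn⟩ := exists_nat_gt (d / (c - d))
  have hn0 : (0 : ℝ) < n := lt_of_le_of_lt (div_nonneg hd0.le (by linarith)) hn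
  have hnc : d * (n + 1) ≤ c * n := by
    rw [div_lt_iff₀ (by linarith)] at hn; linarith
  obtain ⟨v₀, hv₀⟩ := eventually_atTop.1 ((hX.eventually_le hud).and (hY.eventually_le hud))
  -- The spacing `|u|` makes the strips `(v j, v j - u]` disjoint; they are empty for `u ≥ 0`.
  set v : ℕ → ℝ := fun j => v₀ + j * |u| with hv
  have hvv : ∀ j, v₀ ≤ v j := fun j => by simp only [hv]; nlinarith [abs_nonneg u, j.cast_nonneg (α := ℝ)]
  -- For such `z`, a fixed `X ≤ v j - u` leaves `Y` a threshold `z - X ≥ v₀`.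
  filter_upwards [eventually_ge_atTop (v₀ + v n + |u|)] with z hz
  set W : ℕ → Set Ω := fun j => {ω | v j < X ω ∧ X ω ≤ v j - u ∧ z < X ω + Y ω} with hW
  have hstep : ∀ j < n, P {ω | z - u < X ω + Y ω} ≤
      ENNReal.ofReal d * (P {ω | z < X ω + Y ω} + P (W j)) := by
    intro j hj
    have hvn : v j ≤ v n := by
      have : (j : ℝ) ≤ n := by exact_mod_cast hj.le
      simp only [hv]; nlinarith [abs_nonneg u]
    have ha : P {ω | Y ω ≤ z - v j ∧ z - u < X ω + Y ω} ≤
        ENNReal.ofReal d * P {ω | Y ω ≤ z - v j ∧ z < X ω + Y ω} := by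
      refine hXY.measure_le_mul_of_fiber_right hmX hmY
        (S := {q | q.2 ≤ z - v j ∧ z < q.1 + q.2}) (S' := {q | q.2 ≤ z - v j ∧ z - u < q.1 + q.2})
        (by measurability) (by measurability)
        ENNReal.ofReal_ne_top fun y => ?_
      by_cases hy : y ≤ z - v j
      · have := (hv₀ (z - y) (by linarith [hvv j])).1
        simpa only [Set.mem_ofPred_eq, hy, true_and, ← sub_lt_iff_lt_add,
          sub_right_comm z u y] using this
      · simp [hy]
    have hb : P {ω | X ω ≤ v j - u ∧ z - u < X ω + Y ω} ≤
        ENNReal.ofReal d * P {ω | X ω ≤ v j - u ∧ z < X ω + Y ω} := by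
      refine hXY.symm.measure_le_mul_of_fiber_right hmY hmX
        (S := {q | q.2 ≤ v j - u ∧ z < q.2 + q.1}) (S' := {q | q.2 ≤ v j - u ∧ z - u < q.2 + q.1})
        (by measurability) (by measurability)
        ENNReal.ofReal_ne_top fun y => ?_
      by_cases hy : y ≤ v j - u
      · have := (hv₀ (z - y) (by linarith [neg_abs_le u])).2
        simpa only [Set.mem_ofPred_eq, hy, true_and, ← sub_lt_iff_lt_add',
          sub_right_comm z u y] using this
      · simp [hy]
    have hc : P {ω | z - v j < Y ω ∧ v j - u < X ω} ≤
        ENNReal.ofReal d * P {ω | z - v j < Y ω ∧ v j < X ω} := by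
      refine hXY.measure_le_mul_of_fiber_right hmX hmY
        (S := {q | z - v j < q.2 ∧ v j < q.1}) (S' := {q | z - v j < q.2 ∧ v j - u < q.1})
        (by measurability) (by measurability)
        ENNReal.ofReal_ne_top fun y => ?_
      by_cases hy : z - v j < y
      · simpa [hy] using (hv₀ (v j) (hvv j)).1
      · simp [hy]
    have hcover : P {ω | z - u < X ω + Y ω} ≤ P {ω | Y ω ≤ z - v j ∧ z - u < X ω + Y ω} +
        P {ω | X ω ≤ v j - u ∧ z - u < X ω + Y ω} + P {ω | z - v j < Y ω ∧ v j - u < X ω} := by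
      refine (measure_mono ?_).trans ((measure_union_le _ _).trans
        (add_le_add_left (measure_union_le _ _) _))
      intro ω hω
      simp only [Set.mem_ofPred_eq, Set.mem_union] at hω ⊢
      by_cases h1 : Y ω ≤ z - v j
      · exact Or.inl (Or.inl ⟨h1, hω⟩)
      by_cases h2 : X ω ≤ v j - u
      · exact Or.inl (Or.inr ⟨h2, hω⟩)
      · exact Or.inr ⟨not_le.1 h1, not_le.1 h2⟩
    have hpart : P {ω | Y ω ≤ z - v j ∧ z < X ω + Y ω} +
        P {ω | X ω ≤ v j - u ∧ z < X ω + Y ω} + P {ω | z - v j < Y ω ∧ v j < X ω} ≤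
        P {ω | z < X ω + Y ω} + P (W j) := by
      have hb' : P {ω | X ω ≤ v j - u ∧ z < X ω + Y ω} ≤
          P {ω | X ω ≤ v j ∧ z < X ω + Y ω} + P (W j) := by
        refine (measure_mono ?_).trans (measure_union_le _ _)
        rintro ω ⟨h1, h2⟩
        by_cases h3 : X ω ≤ v j
        · exact Or.inl ⟨h3, h2⟩
        · exact Or.inr ⟨not_le.1 h3, h1, h2⟩
      -- On `{X + Y > z}`, `Y ≤ z - v j` forces `X > v j`, and `X ≤ v j` forces `Y > z - v j`; hence
      -- the three events are disjoint.
      have hdis : P {ω | Y ω ≤ z - v j ∧ z < X ω + Y ω} +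
          P {ω | X ω ≤ v j ∧ z < X ω + Y ω} + P {ω | z - v j < Y ω ∧ v j < X ω} ≤
          P {ω | z < X ω + Y ω} := by
        rw [← measure_union, ← measure_union]
        · refine measure_mono ?_
          rintro ω ((h | h) | h) <;> simp only [Set.mem_ofPred_eq] at h ⊢ <;> linarith
        · rw [Set.disjoint_left]
          rintro ω (h | h) h' <;> simp only [Set.mem_ofPred_eq] at h h' <;> linarith
        · measurability
        · rw [Set.disjoint_left]
          rintro ω h h'; simp only [Set.mem_ofPred_eq] at h h'; linarith
        · measurability
      calc _ ≤ P {ω | Y ω ≤ z - v j ∧ z < X ω + Y ω} +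
          (P {ω | X ω ≤ v j ∧ z < X ω + Y ω} + P (W j)) + P {ω | z - v j < Y ω ∧ v j < X ω} := by
            gcongr
        _ = P {ω | Y ω ≤ z - v j ∧ z < X ω + Y ω} +
          P {ω | X ω ≤ v j ∧ z < X ω + Y ω} + P {ω | z - v j < Y ω ∧ v j < X ω} + P (W j) := by
            ring
        _ ≤ _ := by gcongr
    refine hcover.trans ((add_le_add (add_le_add ha hb) hc).trans ?_)
    rw [← mul_add, ← mul_add]
    gcongr
  have hsum : ∑ j ∈ Finset.range n, P (W j) ≤ P {ω | z < X ω + Y ω} := by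
    rw [← measure_biUnion_finset]
    · refine measure_mono (Set.iUnion₂_subset fun j _ ω hω => hω.2.2)
    · intro i _ j _ hij
      wlog hlt : i < j generalizing i j
      · exact (this ‹_› ‹_› hij.symm (lt_of_le_of_ne (not_lt.1 hlt) hij.symm)).symm
      rw [Function.onFun, Set.disjoint_left]
      rintro ω ⟨-, h1, -⟩ ⟨h2, -, -⟩
      have : ((i : ℝ) + 1) ≤ j := by exact_mod_cast hlt
      simp only [hv] at h1 h2
      nlinarith [abs_nonneg u, neg_abs_le u]
    · intro j _
      simp only [hW]
      measurability
  have htot : (n : ℝ≥0∞) * P {ω | z - u < X ω + Y ω} ≤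
      ENNReal.ofReal d * ((n + 1) * P {ω | z < X ω + Y ω}) := by
    calc (n : ℝ≥0∞) * P {ω | z - u < X ω + Y ω}
        = ∑ j ∈ Finset.range n, P {ω | z - u < X ω + Y ω} := by simp
      _ ≤ ∑ j ∈ Finset.range n, ENNReal.ofReal d * (P {ω | z < X ω + Y ω} + P (W j)) :=
        Finset.sum_le_sum fun j hj => hstep j (Finset.mem_range.1 hj)
      _ = ENNReal.ofReal d * (n * P {ω | z < X ω + Y ω} + ∑ j ∈ Finset.range n, P (W j)) := by
        rw [← Finset.mul_sum, Finset.sum_add_distrib]; simp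
      _ ≤ _ := by
        rw [add_mul, one_mul]; gcongr
  have hr := ENNReal.toReal_mono (by finiteness) htot
  rw [ENNReal.toReal_mul, ENNReal.toReal_mul, ENNReal.toReal_mul, ENNReal.toReal_ofReal hd0.le,
    ENNReal.toReal_add (by finiteness) (by finiteness)] at hr
  simp only [ENNReal.toReal_natCast, ENNReal.toReal_one] at hr
  rw [← ofReal_measureReal (μ := P), ← ofReal_measureReal (μ := P),
    ← ENNReal.ofReal_mul (hd0.trans hdc).le]
  refine ENNReal.ofReal_le_ofReal (le_of_mul_le_mul_left ?_ hn0)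
  refine hr.trans ?_
  change d * ((n + 1) * P.real {ω | z < X ω + Y ω}) ≤ n * (c * P.real {ω | z < X ω + Y ω})
  nlinarith [measureReal_nonneg (μ := P) (s := {ω | z < X ω + Y ω})]

end Tails

/-! ### Regular variation, Breiman's lemma and exponential moments -/

section RegularVariation

variable {Ω : Type*} [MeasurableSpace Ω] {P : Measure Ω}

theorem HasExpTail.hasRegularlyVaryingTail_exp {Y : Ω → ℝ} (hY : HasExpTail P Y) :
    HasRegularlyVaryingTail P (fun ω => Real.exp (Y ω)) (-1) := by
  have key : ∀ x : ℝ, 0 < x → {ω | x < Real.exp (Y ω)} = {ω | Real.log x < Y ω} := by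
    intro x hx; ext ω; exact (Real.log_lt_iff_lt_exp hx).symm
  refine ⟨?_, fun s hs => ?_⟩
  · filter_upwards [eventually_gt_atTop 0] with x hx
    rw [key x hx]; exact hY.pos _
  · have h := (hY.tendsto (-Real.log s)).comp Real.tendsto_log_atTop
    rw [Real.exp_neg, Real.exp_log hs, ← Real.rpow_neg_one] at h
    refine h.congr' ?_
    filter_upwards [eventually_gt_atTop 0] with x hx
    rw [key x hx, key _ (mul_pos hs hx), Real.log_mul hs.ne' hx.ne']
    simp [add_comm]

theorem HasRegularlyVaryingTail.pos [IsFiniteMeasure P] {Z : Ω → ℝ} {ρ : ℝ}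
    (hZ : HasRegularlyVaryingTail P Z ρ) (x : ℝ) : 0 < P.real {ω | x < Z ω} := by
  obtain ⟨y, hy, hxy⟩ := (hZ.1.and (eventually_ge_atTop x)).exists
  exact hy.trans_le (antitone_survival Z hxy)

theorem HasRegularlyVaryingTail.congr_ae {Z Z' : Ω → ℝ} {ρ : ℝ}
    (hZ : HasRegularlyVaryingTail P Z ρ) (h : Z =ᵐ[P] Z') : HasRegularlyVaryingTail P Z' ρ := by
  have key : ∀ x, P.real {ω | x < Z' ω} = P.real {ω | x < Z ω} := fun x =>
    measureReal_congr (by filter_upwards [h] with ω hω; exact congrArg (x < ·) hω.symm)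
  simpa only [HasRegularlyVaryingTail, key] using hZ

theorem HasRegularlyVaryingTail.of_tendsto_div [IsFiniteMeasure P] {Z Z' : Ω → ℝ} {ρ c : ℝ}
    (hZ : HasRegularlyVaryingTail P Z ρ) (hc : 0 < c)
    (h : Tendsto (fun x => P.real {ω | x < Z' ω} / P.real {ω | x < Z ω}) atTop (𝓝 c)) :
    HasRegularlyVaryingTail P Z' ρ := by
  have hpos : ∀ᶠ x in atTop, 0 < P.real {ω | x < Z' ω} := by
    filter_upwards [h.eventually_const_lt hc] with x hx
    exact (div_pos_iff_of_pos_right (hZ.pos x)).1 hx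
  refine ⟨hpos, fun s hs => ?_⟩
  have h1 := h.comp (tendsto_id.const_mul_atTop hs)
  have h2 : Tendsto _ atTop (𝓝 (c * s ^ ρ / c)) := (h1.mul (hZ.2 s hs)).div h hc.ne'
  rw [mul_div_cancel_left₀ _ hc.ne'] at h2
  refine h2.congr' ?_
  filter_upwards [hpos] with x hx
  have a := (hZ.pos x).ne'
  have b := (hZ.pos (s * x)).ne'
  simp only [Function.comp_apply, id, Pi.div_apply]
  field_simp

/-- A Potter bound. -/
theorem HasRegularlyVaryingTail.exists_survival_div_le [IsProbabilityMeasure P] {Z : Ω → ℝ}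
    (hZ : HasRegularlyVaryingTail P Z (-1)) {p : ℝ} (hp : 1 < p) :
    ∃ C : ℝ, ∀ᶠ x in atTop, ∀ r, 0 < r →
      P.real {ω | x / r < Z ω} ≤ C * (1 + r ^ p) * P.real {ω | x < Z ω} := by
  set T : ℝ → ℝ := fun x => P.real {ω | x < Z ω} with hT
  have hanti : Antitone T := antitone_survival Z
  have hTpos : ∀ x, 0 < T x := hZ.pos
  have hT1 : ∀ x, T x ≤ 1 := fun x => measureReal_le_one
  have h2p : (2 : ℝ) < 2 ^ p := by
    simpa using Real.rpow_lt_rpow_of_exponent_lt (by norm_num : (1 : ℝ) < 2) hp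
  have hlim := hZ.2 (1 / 2) (by norm_num)
  rw [show ((1 / 2 : ℝ) ^ (-1 : ℝ)) = 2 by rw [Real.rpow_neg_one]; norm_num] at hlim
  obtain ⟨x₀, hx₀⟩ := eventually_atTop.1 ((hlim.eventually_lt_const h2p).and
    (eventually_ge_atTop 0))
  have hhalf : ∀ x, x₀ ≤ x → T (x / 2) ≤ 2 ^ p * T x := by
    intro x hx
    have := (div_le_iff₀ (hTpos x)).1 (hx₀ x hx).1.le
    rwa [one_div, inv_mul_eq_div] at this
  -- With this `C`, `C * T y ≥ 1` for `y ≤ x₀`, so the bound is trivial once repeated halving drops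
  -- below `x₀`.
  set C : ℝ := (T x₀)⁻¹ with hC
  have hC1 : 1 ≤ C := (one_le_inv₀ (hTpos x₀)).2 (hT1 x₀)
  have h2p1 : (1 : ℝ) ≤ 2 ^ p := by linarith
  have hind : ∀ n : ℕ, ∀ x, x₀ ≤ x → T (x / 2 ^ n) ≤ C * (2 ^ p) ^ n * T x := by
    intro n
    induction n with
    | zero =>
      intro x _
      simpa using le_mul_of_one_le_left (hTpos x).le hC1
    | succ n ih =>
      intro x hx
      have hq : (0 : ℝ) ≤ C * (2 ^ p) ^ n := by positivity
      have hmain : T (x / 2 ^ (n + 1)) ≤ C * (2 ^ p) ^ n * T (x / 2) := by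
        by_cases hx2 : x₀ ≤ x / 2
        · have := ih (x / 2) hx2
          rwa [div_div, ← pow_succ'] at this
        · have h1 : 1 ≤ C * T (x / 2) := by
            rw [hC, inv_mul_eq_div, one_le_div (hTpos x₀)]
            exact hanti (not_le.1 hx2).le
          have h2 : (1 : ℝ) ≤ (2 ^ p) ^ n := one_le_pow₀ h2p1
          calc T (x / 2 ^ (n + 1)) ≤ 1 * 1 := by simpa using hT1 _
            _ ≤ (C * T (x / 2)) * (2 ^ p) ^ n := by gcongr
            _ = _ := by ring
      calc _ ≤ C * (2 ^ p) ^ n * T (x / 2) := hmain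
        _ ≤ C * (2 ^ p) ^ n * (2 ^ p * T x) := by gcongr; exact hhalf x hx
        _ = _ := by ring
  refine ⟨C * 2 ^ p, ?_⟩
  filter_upwards [eventually_ge_atTop x₀] with x hx r hr
  have hx0 : 0 ≤ x := (hx₀ x hx).2
  by_cases hr1 : r ≤ 1
  · calc T (x / r) ≤ T x := hanti (by rw [le_div_iff₀ hr]; nlinarith)
      _ ≤ C * 2 ^ p * (1 + r ^ p) * T x := by
        refine le_mul_of_one_le_left (hTpos x).le ?_
        have : 0 ≤ r ^ p := Real.rpow_nonneg hr.le p
        have : 1 ≤ C * 2 ^ p := one_le_mul_of_one_le_of_one_le hC1 h2p1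
        nlinarith
  · obtain ⟨n, hn, hn'⟩ := exists_nat_pow_near (not_le.1 hr1).le (by norm_num : (1 : ℝ) < 2)
    have hrp : ((2 : ℝ) ^ p) ^ n ≤ r ^ p := by
      rw [← Real.rpow_natCast, ← Real.rpow_mul (by norm_num), mul_comm p, Real.rpow_mul (by norm_num),
        Real.rpow_natCast]
      exact Real.rpow_le_rpow (by positivity) hn (by linarith)
    calc T (x / r) ≤ T (x / 2 ^ (n + 1)) := hanti (by gcongr)
      _ ≤ C * (2 ^ p) ^ (n + 1) * T x := hind _ x hx
      _ = C * 2 ^ p * (2 ^ p) ^ n * T x := by ring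
      _ ≤ C * 2 ^ p * (1 + r ^ p) * T x := by
        have := (hTpos x).le
        gcongr; linarith

/-- **Breiman's lemma** for tails of index `-1`. -/
theorem HasRegularlyVaryingTail.tendsto_survival_mul_div [IsProbabilityMeasure P] {Z R : Ω → ℝ}
    (hZ : HasRegularlyVaryingTail P Z (-1)) (hmZ : Measurable Z) (hmR : Measurable R)
    (hR : ∀ ω, 0 ≤ R ω) (hZR : IndepFun Z R P) {p : ℝ} (hp : 1 < p)
    (hint : Integrable (fun ω => R ω ^ p) P) :
    Tendsto (fun x => P.real {ω | x < Z ω * R ω} / P.real {ω | x < Z ω}) atTop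
      (𝓝 (∫ ω, R ω ∂P)) := by
  set T : ℝ → ℝ := fun x => P.real {ω | x < Z ω} with hT
  have hanti : Antitone T := antitone_survival Z
  have hTpos : ∀ x, 0 < T x := hZ.pos
  obtain ⟨C, hC⟩ := hZ.exists_survival_div_le hp
  -- Integrate out `Z` given `R`; where `R = 0` the product cannot exceed `x > 0`.
  have key : ∀ x, 0 < x → P.real {ω | x < Z ω * R ω} =
      ∫ ω, (if 0 < R ω then T (x / R ω) else 0) ∂P := by
    intro x hx
    have hA : MeasurableSet {q : ℝ × ℝ | x < q.1 * q.2} := by measurability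
    have h1 : P {ω | x < Z ω * R ω} = P.map (fun ω => (Z ω, R ω)) {q | x < q.1 * q.2} :=
      (Measure.map_apply (hmZ.prodMk hmR) hA).symm
    have hm : Measurable fun r => (if 0 < r then T (x / r) else 0) :=
      Measurable.ite measurableSet_Ioi (hanti.measurable.comp (measurable_const.div measurable_id))
        measurable_const
    have h0 : ∀ r : ℝ, 0 ≤ (if 0 < r then T (x / r) else 0) := by
      intro r; split_ifs
      · exact (hTpos _).le
      · exact le_rfl
    rw [integral_eq_lintegral_of_nonneg_ae (Eventually.of_forall fun ω => h0 _)
      (hm.comp hmR).aestronglyMeasurable, Measure.real, h1,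
      hZR.map_prod_eq_prod_map_map hmZ.aemeasurable hmR.aemeasurable,
      Measure.prod_apply_symm hA, lintegral_map (measurable_measure_prodMk_right hA) hmR]
    congr 1
    refine lintegral_congr fun ω => ?_
    rw [Measure.map_apply hmZ (measurable_prodMk_right hA)]
    split_ifs with h
    · rw [ofReal_measureReal]
      congr 1; ext ω'
      exact (div_lt_iff₀ h).symm
    · have : R ω = 0 := le_antisymm (not_lt.1 h) (hR ω)
      simp [this, not_lt.2 hx.le]
  have hdom : Tendsto (fun x => ∫ ω, (if 0 < R ω then T (x / R ω) else 0) / T x ∂P) atTop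
      (𝓝 (∫ ω, R ω ∂P)) := by
    -- The Potter bound dominates the ratio, and regular variation at scale `1 / R` gives the
    -- pointwise limit `R`.
    refine tendsto_integral_filter_of_dominated_convergence (fun ω => |C| * (1 + R ω ^ p))
      ?_ ?_ (((integrable_const 1).add hint).const_mul _) ?_
    · refine Eventually.of_forall fun x => Measurable.aestronglyMeasurable ?_
      exact (Measurable.ite (hmR measurableSet_Ioi)
        (hanti.measurable.comp (measurable_const.div hmR)) measurable_const).div_const _
    · filter_upwards [hC] with x hx
      refine Eventually.of_forall fun ω => ?_
      have hnn : 0 ≤ 1 + R ω ^ p := by have := Real.rpow_nonneg (hR ω) p; linarith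
      split_ifs with h
      · rw [Real.norm_of_nonneg (div_nonneg (hTpos _).le (hTpos _).le), div_le_iff₀ (hTpos x)]
        refine (hx _ h).trans ?_
        have := (hTpos x).le
        gcongr
        exact le_abs_self C
      · simpa using mul_nonneg (abs_nonneg C) hnn
    · refine Eventually.of_forall fun ω => ?_
      split_ifs with h
      · have := hZ.2 (R ω)⁻¹ (inv_pos.2 h)
        rw [Real.rpow_neg_one, inv_inv] at this
        simpa only [hT, inv_mul_eq_div] using this
      · have : R ω = 0 := le_antisymm (not_lt.1 h) (hR ω)
        simp [this]
  refine hdom.congr' ?_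
  filter_upwards [eventually_gt_atTop 0] with x hx
  rw [key x hx, integral_div]

/-- For `s < q < 1`, each unit step eventually shrinks the tail by a factor below `e^{-q}`, so the
unit layers of `exp (s * Y)` are dominated by a geometric series of ratio `e^{s-q}`. -/
theorem HasExpTail.integrable_exp_mul [IsProbabilityMeasure P] {Y : Ω → ℝ} (hY : HasExpTail P Y)
    (hmY : Measurable Y) {s : ℝ} (hs0 : 0 ≤ s) (hs1 : s < 1) :
    Integrable (fun ω => Real.exp (s * Y ω)) P := by
  obtain ⟨q, hsq, hq1⟩ := exists_between hs1
  have hlt : Real.exp (-1) < Real.exp (-q) := Real.exp_lt_exp.2 (by linarith)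
  obtain ⟨z₀, hz₀⟩ := eventually_atTop.1 ((hY.tendsto (-1)).eventually_lt_const hlt)
  have hstep : ∀ n : ℕ, P.real {ω | z₀ + n < Y ω} ≤ Real.exp (-q) ^ n := by
    intro n
    induction n with
    | zero => simp
    | succ n ih =>
      have h1 := (div_lt_iff₀ (hY.pos _)).1 (hz₀ (z₀ + n) (by simp))
      rw [pow_succ']
      push_cast
      simp only [sub_neg_eq_add, add_assoc] at h1 ⊢
      exact h1.le.trans (mul_le_mul_of_nonneg_left ih (Real.exp_pos _).le)
  have hbound : ∀ ω, ENNReal.ofReal (Real.exp (s * Y ω)) ≤ ENNReal.ofReal (Real.exp (s * z₀)) +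
      ∑' n : ℕ, {ω | z₀ + n < Y ω}.indicator
        (fun _ => ENNReal.ofReal (Real.exp (s * (z₀ + n + 1)))) ω := by
    intro ω
    by_cases h : Y ω ≤ z₀
    · refine le_add_right (ENNReal.ofReal_le_ofReal (Real.exp_le_exp.2 ?_))
      gcongr
    · have h' : 0 < Y ω - z₀ := by linarith
      have hc := Nat.ceil_lt_add_one h'.le
      have hc' := Nat.le_ceil (Y ω - z₀)
      obtain ⟨n, hn⟩ := Nat.exists_eq_succ_of_ne_zero (Nat.ceil_pos.2 h').ne'
      rw [hn] at hc hc'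
      push_cast at hc hc'
      refine le_add_left (le_trans ?_ (ENNReal.le_tsum n))
      rw [Set.indicator_of_mem (by simp only [Set.mem_ofPred_eq]; linarith)]
      refine ENNReal.ofReal_le_ofReal (Real.exp_le_exp.2 ?_)
      gcongr
      linarith
  refine ⟨(by fun_prop : Measurable fun ω => Real.exp (s * Y ω)).aestronglyMeasurable, ?_⟩
  rw [hasFiniteIntegral_iff_ofReal (Eventually.of_forall fun ω => (Real.exp_pos _).le)]
  refine (lintegral_mono hbound).trans_lt ?_
  have hmeas : ∀ n : ℕ, MeasurableSet {ω | z₀ + n < Y ω} := fun n => hmY measurableSet_Ioi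
  rw [lintegral_add_left measurable_const, lintegral_tsum fun n =>
    (measurable_const.indicator (hmeas n)).aemeasurable]
  refine ENNReal.add_lt_top.2 ⟨by simp, ?_⟩
  have hterm : ∀ n : ℕ, ∫⁻ ω, {ω | z₀ + n < Y ω}.indicator
        (fun _ => ENNReal.ofReal (Real.exp (s * (z₀ + n + 1)))) ω ∂P ≤
      ENNReal.ofReal (Real.exp (s * (z₀ + 1)) * Real.exp (s - q) ^ n) := by
    intro n
    rw [lintegral_indicator_const (hmeas n), ← ofReal_measureReal,
      ← ENNReal.ofReal_mul (Real.exp_pos _).le]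
    refine ENNReal.ofReal_le_ofReal ?_
    calc _ ≤ Real.exp (s * (z₀ + n + 1)) * Real.exp (-q) ^ n := by gcongr; exact hstep n
      _ = _ := by
        rw [← Real.exp_nat_mul, ← Real.exp_nat_mul, ← Real.exp_add, ← Real.exp_add]
        ring_nf
  refine (ENNReal.tsum_le_tsum hterm).trans_lt ?_
  rw [← ENNReal.ofReal_tsum_of_nonneg (fun n => by positivity)]
  · exact ENNReal.ofReal_lt_top
  · exact (summable_geometric_of_lt_one (Real.exp_pos _).le
      (Real.exp_lt_one_iff.2 (by linarith))).mul_left _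

end RegularVariation

/-! ### Tails, convergence and moments of weighted sums -/

section LinearProcess

variable {Ω : Type*} [MeasurableSpace Ω] {P : Measure Ω}

theorem HasExpTail.of_map {Y : Ω → ℝ} (hY : Measurable Y) (h : HasExpTail (P.map Y) id) :
    HasExpTail P Y := by
  have key : ∀ z, (P.map Y).real {x | z < id x} = P.real {ω | z < Y ω} := fun z =>
    map_measureReal_apply hY measurableSet_Ioi
  exact ⟨fun z => key z ▸ h.pos z, fun u => by simpa only [key] using h.tendsto u⟩

/-- The power factor disappears in the limit, since `((z - u) / z) ^ β → 1`; only the exponential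
sees the shift. -/
theorem IsGammaTypeLaw.hasExpTail {μ : Measure ℝ} [IsFiniteMeasure μ] (h : IsGammaTypeLaw μ) :
    HasExpTail μ id := by
  obtain ⟨β, K, -, hK, hequiv⟩ := h.tail
  set g : ℝ → ℝ := fun z => K * z ^ β * Real.exp (-z) with hg
  have hgpos : ∀ z, 0 < z → 0 < g z := fun z hz => by simp only [hg]; positivity
  have hgne : ∀ᶠ z in atTop, g z ≠ 0 := by
    filter_upwards [eventually_gt_atTop 0] with z hz using (hgpos z hz).ne'
  have hlim := (Asymptotics.isEquivalent_iff_tendsto_one hgne).1 hequiv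
  have hpos : ∀ z, 0 < μ.real (Set.Ioi z) := by
    intro z
    obtain ⟨y, hy, hy0, hzy⟩ := ((hlim.eventually_const_lt one_pos).and
      ((eventually_gt_atTop 0).and (eventually_ge_atTop z))).exists
    exact ((div_pos_iff_of_pos_right (hgpos y hy0)).1 hy).trans_le
      (measureReal_mono (Set.Ioi_subset_Ioi hzy))
  refine ⟨hpos, fun u => ?_⟩
  have hshift : Tendsto (fun z : ℝ => z - u) atTop atTop :=
    tendsto_atTop_add_const_right atTop (-u) tendsto_id
  have hgg : Tendsto (fun z => g (z - u) / g z) atTop (𝓝 (Real.exp u)) := by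
    have h1 : Tendsto (fun z : ℝ => 1 - u / z) atTop (𝓝 1) := by
      simpa using (tendsto_const_nhds (x := (1 : ℝ))).sub (tendsto_id.const_div_atTop u)
    have h2 := (h1.rpow_const (p := β) (Or.inl one_ne_zero)).mul_const (Real.exp u)
    rw [Real.one_rpow, one_mul] at h2
    refine h2.congr' ?_
    filter_upwards [eventually_gt_atTop 0, eventually_gt_atTop u] with z hz hzu
    have h3 : 1 - u / z = (z - u) / z := by field_simp
    rw [h3, Real.div_rpow (by linarith) hz.le]
    simp only [hg]
    rw [show -(z - u) = -z + u by ring, Real.exp_add]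
    have := (Real.rpow_pos_of_pos hz β).ne'
    field_simp
  have h4 : Tendsto _ atTop (𝓝 (1 * Real.exp u / 1)) :=
    ((hlim.comp hshift).mul hgg).div hlim one_ne_zero
  rw [one_mul, div_one] at h4
  refine h4.congr' ?_
  filter_upwards [eventually_gt_atTop 0, eventually_gt_atTop u] with z hz hzu
  have a := (hgpos z hz).ne'
  have b := (hgpos (z - u) (by linarith)).ne'
  have c := (hpos z).ne'
  have d := (hpos (z - u)).ne'
  change (μ.real (Set.Ioi (z - u)) / g (z - u) * (g (z - u) / g z)) /
    (μ.real (Set.Ioi z) / g z) = μ.real (Set.Ioi (z - u)) / μ.real (Set.Ioi z)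
  field_simp

theorem HasExpTail.sum [IsProbabilityMeasure P] {Y : ℕ → Ω → ℝ} (hind : iIndepFun Y P)
    (hm : ∀ i, Measurable (Y i)) (hY : ∀ i, HasExpTail P (Y i)) {s : Finset ℕ}
    (hs : s.Nonempty) : HasExpTail P (fun ω => ∑ i ∈ s, Y i ω) := by
  induction hs using Finset.Nonempty.cons_induction with
  | singleton a => simpa using hY a
  | cons a s ha _ ih =>
    have h := (hind.indepFun_finsetSum_of_notMem hm ha).symm
    have h' : IndepFun (Y a) (fun ω => ∑ i ∈ s, Y i ω) P := by
      convert h using 1; ext ω; simp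
    simpa only [Finset.sum_cons] using
      HasExpTail.add h' (hm a) (Finset.measurable_sum s fun i _ => hm i) (hY a) ih

theorem ae_summable_mul_of_integral_abs_le {a : ℕ → ℝ} (ha : Summable a) (ha0 : ∀ i, 0 ≤ a i)
    {Y : ℕ → Ω → ℝ} (hY : ∀ i, Integrable (Y i) P) {C : ℝ} (hC : ∀ i, ∫ ω, |Y i ω| ∂P ≤ C) :
    ∀ᵐ ω ∂P, Summable fun i => a i * Y i ω := by
  have hterm : ∀ i, ∫⁻ ω, ‖a i * Y i ω‖ₑ ∂P ≤ ENNReal.ofReal (a i * C) := by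
    intro i
    rw [← ofReal_integral_norm_eq_lintegral_enorm ((hY i).const_mul _)]
    refine ENNReal.ofReal_le_ofReal ?_
    simp only [norm_mul, Real.norm_eq_abs, abs_of_nonneg (ha0 i), integral_const_mul]
    exact mul_le_mul_of_nonneg_left (hC i) (ha0 i)
  have hfin : ∫⁻ ω, ∑' i, ‖a i * Y i ω‖ₑ ∂P ≠ ⊤ := by
    rw [lintegral_tsum fun i => ((hY i).const_mul _).aestronglyMeasurable.enorm]
    exact ne_top_of_le_ne_top (ha.mul_right C).tsum_ofReal_ne_top (ENNReal.tsum_le_tsum hterm)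
  filter_upwards [ae_lt_top' (AEMeasurable.tsum fun i =>
    ((hY i).const_mul _).aestronglyMeasurable.enorm) hfin] with ω hω
  exact (ENNReal.tsum_coe_ne_top_iff_summable.1 hω.ne).of_nnnorm

/-- Convexity of `exp` between `0` and `c * Y i` gives `E exp (b i * Y i) ≤ exp (b i * m / c)`. By
independence the partial sums have exponential moments bounded through `∑ b i`, and Fatou passes to
the limit. -/
theorem integrable_exp_tsum_mul [IsProbabilityMeasure P] {Y : ℕ → Ω → ℝ} (hind : iIndepFun Y P)
    (hm : ∀ i, Measurable (Y i)) {b : ℕ → ℝ} (hb : Summable b) (hb0 : ∀ i, 0 ≤ b i) {c m : ℝ}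
    (hc : 0 < c) (hbc : ∀ i, b i ≤ c) (hint : ∀ i, Integrable (fun ω => Real.exp (c * Y i ω)) P)
    (hle : ∀ i, ∫ ω, Real.exp (c * Y i ω) ∂P ≤ m)
    (hsum : ∀ᵐ ω ∂P, Summable fun i => b i * Y i ω) :
    Integrable (fun ω => Real.exp (∑' i, b i * Y i ω)) P := by
  have hm0 : 0 ≤ m := (integral_nonneg fun ω => (Real.exp_pos _).le).trans (hle 0)
  have hpt : ∀ i ω, Real.exp (b i * Y i ω) ≤ (1 - b i / c) + b i / c * Real.exp (c * Y i ω) := by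
    intro i ω
    have h1 : 0 ≤ b i / c := div_nonneg (hb0 i) hc.le
    have h2 : b i / c ≤ 1 := (div_le_one hc).2 (hbc i)
    have := convexOn_exp.2 (Set.mem_univ 0) (Set.mem_univ (c * Y i ω)) (sub_nonneg.2 h2) h1
      (by ring)
    simp only [smul_eq_mul, mul_zero, zero_add, Real.exp_zero, mul_one] at this
    rwa [← mul_assoc, div_mul_cancel₀ _ hc.ne'] at this
  have hinti : ∀ i, Integrable (fun ω => Real.exp (b i * Y i ω)) P := fun i => by
    refine Integrable.mono' ((integrable_const (1 - b i / c)).add ((hint i).const_mul (b i / c)))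
      (by have := hm i; fun_prop) (Eventually.of_forall fun ω => ?_)
    rw [Real.norm_of_nonneg (Real.exp_pos _).le]
    exact hpt i ω
  have hmgf : ∀ i, ∫ ω, Real.exp (b i * Y i ω) ∂P ≤ Real.exp (b i * (m / c)) := by
    intro i
    have h1 : 0 ≤ b i / c := div_nonneg (hb0 i) hc.le
    calc ∫ ω, Real.exp (b i * Y i ω) ∂P
        ≤ ∫ ω, ((1 - b i / c) + b i / c * Real.exp (c * Y i ω)) ∂P :=
          integral_mono (hinti i) ((integrable_const _).add ((hint i).const_mul _)) (hpt i)
      _ = (1 - b i / c) + b i / c * ∫ ω, Real.exp (c * Y i ω) ∂P := by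
          rw [integral_add (integrable_const _) ((hint i).const_mul _), integral_const_mul]
          simp
      _ ≤ (1 - b i / c) + b i / c * m := by gcongr; exact hle i
      _ ≤ b i * (m / c) + 1 := by
          rw [mul_div_assoc', div_mul_eq_mul_div]; linarith
      _ ≤ _ := Real.add_one_le_exp _
  have hind' : iIndepFun (fun i ω => b i * Y i ω) P :=
    hind.comp (fun i y => b i * y) fun i => measurable_const_mul _
  have hm' : ∀ i, Measurable fun ω => b i * Y i ω := fun i => (hm i).const_mul _
  set B : ℝ := Real.exp ((∑' i, b i) * (m / c)) with hB
  have hpart : ∀ n : ℕ,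
      ∫⁻ ω, ENNReal.ofReal (Real.exp (∑ i ∈ Finset.range n, b i * Y i ω)) ∂P ≤
        ENNReal.ofReal B := by
    intro n
    have h1 := hind'.integrable_exp_mul_sum (t := 1) hm' (s := Finset.range n)
      (fun i _ => by simpa using hinti i)
    have h2 := hind'.mgf_sum (t := 1) hm' (Finset.range n)
    simp only [mgf, one_mul, Finset.sum_apply] at h1 h2
    rw [← ofReal_integral_eq_lintegral_ofReal h1 (Eventually.of_forall fun ω => (Real.exp_pos _).le),
      h2]
    refine ENNReal.ofReal_le_ofReal ?_
    calc ∏ i ∈ Finset.range n, ∫ ω, Real.exp (b i * Y i ω) ∂P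
        ≤ ∏ i ∈ Finset.range n, Real.exp (b i * (m / c)) :=
          Finset.prod_le_prod (fun i _ => integral_nonneg fun ω => (Real.exp_pos _).le)
            fun i _ => hmgf i
      _ = Real.exp ((∑ i ∈ Finset.range n, b i) * (m / c)) := by
          rw [← Real.exp_sum, Finset.sum_mul]
      _ ≤ B := by
          refine Real.exp_le_exp.2 (mul_le_mul_of_nonneg_right ?_ (div_nonneg hm0 hc.le))
          exact hb.sum_le_tsum _ fun i _ => hb0 i
  have hlim : ∀ᵐ ω ∂P, Tendsto (fun n : ℕ => Real.exp (∑ i ∈ Finset.range n, b i * Y i ω)) atTop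
      (𝓝 (Real.exp (∑' i, b i * Y i ω))) := by
    filter_upwards [hsum] with ω hω
    exact (Real.continuous_exp.tendsto _).comp hω.hasSum.tendsto_sum_nat
  have hmn : ∀ n : ℕ, Measurable fun ω => Real.exp (∑ i ∈ Finset.range n, b i * Y i ω) :=
    fun n => Real.measurable_exp.comp (Finset.measurable_sum _ fun i _ => hm' i)
  refine ⟨aestronglyMeasurable_of_tendsto_ae atTop (fun n => (hmn n).aestronglyMeasurable) hlim, ?_⟩
  rw [hasFiniteIntegral_iff_ofReal (Eventually.of_forall fun ω => (Real.exp_pos _).le)]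
  calc ∫⁻ ω, ENNReal.ofReal (Real.exp (∑' i, b i * Y i ω)) ∂P
      = ∫⁻ ω, liminf (fun n : ℕ =>
          ENNReal.ofReal (Real.exp (∑ i ∈ Finset.range n, b i * Y i ω))) atTop ∂P := by
        refine lintegral_congr_ae ?_
        filter_upwards [hlim] with ω hω
        exact ((ENNReal.continuous_ofReal.tendsto _).comp hω).liminf_eq.symm
    _ ≤ liminf (fun n : ℕ => ∫⁻ ω,
          ENNReal.ofReal (Real.exp (∑ i ∈ Finset.range n, b i * Y i ω)) ∂P) atTop :=
        lintegral_liminf_le fun n => (hmn n).ennreal_ofReal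
    _ ≤ liminf (fun _ : ℕ => ENNReal.ofReal B) atTop :=
        liminf_le_liminf (Eventually.of_forall hpart)
    _ < ⊤ := by simp

/-- As `a` vanishes on `s`, the two sums are measurable for the σ-algebras generated by disjoint
sets of indices. -/
theorem ProbabilityTheory.iIndepFun.indepFun_sum_tsum_mul {Y : ℕ → Ω → ℝ} (hind : iIndepFun Y P)
    (hm : ∀ i, Measurable (Y i)) {s : Finset ℕ} {a : ℕ → ℝ} (ha : ∀ i ∈ s, a i = 0) :
    IndepFun (fun ω => ∑ i ∈ s, Y i ω) (fun ω => ∑' i, a i * Y i ω) P := by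
  have h := indep_iSup_of_disjoint (fun i => (hm i).comap_le) hind.iIndep
    (disjoint_compl_right (a := (s : Set ℕ)))
  have hmem : ∀ (T : Set ℕ) i, i ∈ T →
      Measurable[⨆ i ∈ T, MeasurableSpace.comap (Y i) inferInstance] (Y i) := fun T i hi =>
    Measurable.mono (comap_measurable (Y i))
      (le_iSup₂ (f := fun i (_ : i ∈ T) => MeasurableSpace.comap (Y i) inferInstance) i hi) le_rfl
  rw [IndepFun_iff_Indep]
  refine indep_of_indep_of_le_left (indep_of_indep_of_le_right h ?_) ?_
  · refine Measurable.comap_le ?_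
    refine @Measurable.tsum _ _ _ (_) _ _ _ _ _ _ _ _ _ _ _ _ fun i => ?_
    by_cases hi : i ∈ s
    · simp only [ha i hi, zero_mul]
      exact @measurable_const _ _ _ (_) _
    · exact @Measurable.const_mul _ _ _ _ (_) _ _ (hmem _ i (by simpa using hi)) _
  · refine Measurable.comap_le ?_
    exact @Finset.measurable_sum _ _ _ _ _ _ (_) _ _ fun i hi => hmem _ i (by simpa using hi)

end LinearProcess

/-! ### The stochastic volatility model: solutions and stationarity -/

section Model

theorem IsSVCoefficient.summable {α : ℕ → ℝ} (hα : IsSVCoefficient α) : Summable α := by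
  obtain ⟨θ, hθ, h⟩ := hα.isBigO
  exact summable_of_isBigO_nat (Real.summable_nat_rpow.2 (by linarith)) h

theorem IsSVCoefficient.exists_gap {α : ℕ → ℝ} (hα : IsSVCoefficient α) :
    ∃ s : Finset ℕ, s.Nonempty ∧ (∀ i ∈ s, α i = 1) ∧
      ∃ c : ℝ, 0 < c ∧ c < 1 ∧ ∀ i ∉ s, α i ≤ c := by
  classical
  obtain ⟨N, hN⟩ := eventually_atTop.1 (hα.summable.tendsto_atTop_zero.eventually_lt_const
    (by norm_num : (0 : ℝ) < 1 / 2))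
  -- The extra value `1 / 2` makes the maximum positive and bounds all `α i` with `i ≥ N`.
  set T : Finset ℝ := insert (1 / 2) (((Finset.range N).filter fun i => α i ≠ 1).image α) with hT
  have hTne : T.Nonempty := Finset.insert_nonempty _ _
  refine ⟨(Finset.range N).filter fun i => α i = 1, ?_, fun i hi => (Finset.mem_filter.1 hi).2,
    T.max' hTne, ?_, ?_, fun i hi => ?_⟩
  · obtain ⟨i, hi⟩ := hα.max_eq_one.1
    refine ⟨i, Finset.mem_filter.2 ⟨Finset.mem_range.2 (not_le.1 fun hle => ?_), hi⟩⟩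
    have := hN i hle
    linarith
  · exact lt_of_lt_of_le (by norm_num) (T.le_max' _ (Finset.mem_insert_self (1 / 2 : ℝ) _))
  · refine (Finset.max'_lt_iff _ hTne).2 fun y hy => ?_
    simp only [hT, Finset.mem_insert, Finset.mem_image, Finset.mem_filter] at hy
    obtain rfl | ⟨i, ⟨-, hi⟩, rfl⟩ := hy
    · norm_num
    · exact lt_of_le_of_ne (hα.mem_Icc i).2 hi
  · by_cases hiN : i < N
    · refine T.le_max' _ (Finset.mem_insert_of_mem (Finset.mem_image_of_mem _ ?_))
      exact Finset.mem_filter.2 ⟨Finset.mem_range.2 hiN, fun h =>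
        hi (Finset.mem_filter.2 ⟨Finset.mem_range.2 hiN, h⟩)⟩
    · exact (hN i (not_lt.1 hiN)).le.trans (T.le_max' _ (Finset.mem_insert_self _ _))

/-- The log-volatility at time `t` as a function of the path `y` of its innovations. -/
noncomputable def logVolatility (α : ℕ → ℝ) (y : ℤ → ℝ) (t : ℤ) : ℝ :=
  ∑' i : ℕ, α i * y (t - (i : ℤ))

theorem measurable_logVolatility (α : ℕ → ℝ) (t : ℤ) :
    Measurable fun y : ℤ → ℝ => logVolatility α y t :=
  Measurable.tsum fun _ => (measurable_pi_apply _).const_mul _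

/-- The path of the solution as a function of the paths of the innovations. -/
noncomputable def solutionPath (α : ℕ → ℝ) (q : (ℤ → ℝ) × (ℤ → ℝ)) (t : ℤ) : ℝ × ℝ :=
  (Real.exp (logVolatility α q.2 t) * q.1 t, Real.exp (logVolatility α q.2 t))

theorem measurable_solutionPath (α : ℕ → ℝ) : Measurable (solutionPath α) := by
  refine measurable_pi_lambda _ fun t => ?_
  have h : Measurable fun q : (ℤ → ℝ) × (ℤ → ℝ) => Real.exp (logVolatility α q.2 t) :=
    Real.measurable_exp.comp ((measurable_logVolatility α t).comp measurable_snd)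
  exact (h.mul ((measurable_pi_apply t).comp measurable_fst)).prodMk h

theorem solutionPath_shift (α : ℕ → ℝ) (e y : ℤ → ℝ) (h t : ℤ) :
    solutionPath α (e, y) (t + h) = solutionPath α (fun t => e (t + h), fun t => y (t + h)) t := by
  simp only [solutionPath, logVolatility, sub_add_eq_add_sub]

variable {Ω : Type*} [MeasurableSpace Ω] {P : Measure Ω} {α : ℕ → ℝ} {με μη : Measure ℝ}
  {ε η X σ : ℤ → Ω → ℝ}

theorem MeasureTheory.Integrable.of_rpow [IsFiniteMeasure P] {R : Ω → ℝ} (hm : Measurable R)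
    (hR : ∀ ω, 0 ≤ R ω) {p : ℝ} (hp : 1 < p) (h : Integrable (fun ω => R ω ^ p) P) :
    Integrable R P := by
  refine Integrable.mono' ((integrable_const (1 : ℝ)).add h) hm.aestronglyMeasurable
    (Eventually.of_forall fun ω => ?_)
  rw [Real.norm_of_nonneg (hR ω)]
  have h0 := Real.rpow_nonneg (hR ω) p
  by_cases h1 : R ω ≤ 1
  · simp only [Pi.add_apply]; linarith
  · have := Real.rpow_le_rpow_of_exponent_le (not_le.1 h1).le hp.le
    rw [Real.rpow_one] at this
    simp only [Pi.add_apply]; linarith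

theorem IsInnovationPair.ae_summable [IsProbabilityMeasure P] [IsProbabilityMeasure μη]
    (hα : IsSVCoefficient α) (hη : IsGammaTypeLaw μη) (h : IsInnovationPair P με μη ε η)
    {a : ℕ → ℝ} (ha0 : ∀ i, 0 ≤ a i) (ha : ∀ i, a i ≤ α i) (t : ℤ) :
    ∀ᵐ ω ∂P, Summable fun i : ℕ => a i * η (t - (i : ℤ)) ω := by
  have hint : Integrable (fun x : ℝ => x) μη := by
    have : MemLp (fun x : ℝ => x) 2 μη :=
      (memLp_two_iff_integrable_sq measurable_id.aestronglyMeasurable).2 hη.sq_integrable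
    exact this.integrable (by norm_num)
  refine ae_summable_mul_of_integral_abs_le (hα.summable.of_nonneg_of_le ha0 ha) ha0
    (C := ∫ x, |x| ∂μη) (fun i => ?_) fun i => ?_
  · rw [← h.law_η (t - i)] at hint
    exact hint.comp_measurable (h.measurable_η _)
  · rw [← h.law_η (t - i), integral_map (h.measurable_η _).aemeasurable]
    exact continuous_abs.measurable.aestronglyMeasurable

theorem IsInnovationPair.hasSum_logVolatility [IsProbabilityMeasure P] [IsProbabilityMeasure μη]
    (hα : IsSVCoefficient α) (hη : IsGammaTypeLaw μη) (h : IsInnovationPair P με μη ε η) :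
    ∀ᵐ ω ∂P, ∀ t : ℤ, HasSum (fun i : ℕ => α i * η (t - (i : ℤ)) ω)
      (logVolatility α (fun t => η t ω) t) := by
  filter_upwards [ae_all_iff.2 fun t =>
    h.ae_summable hα hη (fun i => (hα.mem_Icc i).1) (fun _ => le_rfl) t] with ω hω t
  exact (hω t).hasSum

theorem IsInnovationPair.measurable_pair (h : IsInnovationPair P με μη ε η) :
    Measurable fun ω => ((fun t => ε t ω, fun t => η t ω) : (ℤ → ℝ) × (ℤ → ℝ)) :=
  (measurable_pi_lambda _ h.measurable_ε).prodMk (measurable_pi_lambda _ h.measurable_η)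

theorem IsInnovationPair.exists_solution [IsProbabilityMeasure P] [IsProbabilityMeasure μη]
    (hα : IsSVCoefficient α) (hη : IsGammaTypeLaw μη) (h : IsInnovationPair P με μη ε η) :
    ∃ X σ : ℤ → Ω → ℝ, IsSVSolution P α ε η X σ := by
  have hm := (measurable_solutionPath α).comp h.measurable_pair
  refine ⟨fun t ω => (solutionPath α (fun t => ε t ω, fun t => η t ω) t).1,
    fun t ω => (solutionPath α (fun t => ε t ω, fun t => η t ω) t).2,
    fun t => measurable_fst.comp ((measurable_pi_apply t).comp hm),
    fun t => measurable_snd.comp ((measurable_pi_apply t).comp hm),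
    Eventually.of_forall fun ω t => Real.exp_pos _, ?_, Eventually.of_forall fun ω t => rfl⟩
  filter_upwards [h.hasSum_logVolatility hα hη] with ω hω t
  simpa only [solutionPath, Real.log_exp] using hω t

theorem IsInnovationPair.shift (h : IsInnovationPair P με μη ε η) (k : ℤ) :
    IsInnovationPair P με μη (fun t => ε (t + k)) (fun t => η (t + k)) where
  measurable_ε t := h.measurable_ε _
  measurable_η t := h.measurable_η _
  indep_ε := h.indep_ε.precomp (add_left_injective k)
  indep_η := h.indep_η.precomp (add_left_injective k)
  law_ε t := h.law_ε _
  law_η t := h.law_η _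
  indep := by
    have hs : Measurable fun (y : ℤ → ℝ) (t : ℤ) => y (t + k) :=
      measurable_pi_lambda _ fun t => measurable_pi_apply _
    exact h.indep.comp hs hs

theorem IsInnovationPair.map_pair [IsProbabilityMeasure P] [IsProbabilityMeasure με]
    [IsProbabilityMeasure μη] (h : IsInnovationPair P με μη ε η) :
    P.map (fun ω => ((fun t => ε t ω, fun t => η t ω) : (ℤ → ℝ) × (ℤ → ℝ))) =
      (Measure.infinitePi fun _ => με).prod (Measure.infinitePi fun _ => μη) := by
  rw [h.indep.map_prod_eq_prod_map_map (measurable_pi_lambda _ h.measurable_ε).aemeasurable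
    (measurable_pi_lambda _ h.measurable_η).aemeasurable,
    h.indep_ε.map_fun_eq_infinitePi_map h.measurable_ε,
    h.indep_η.map_fun_eq_infinitePi_map h.measurable_η]
  simp only [h.law_ε, h.law_η]

theorem IsSVSolution.ae_eq_solutionPath (hsol : IsSVSolution P α ε η X σ) :
    ∀ᵐ ω ∂P, ∀ t, (X t ω, σ t ω) = solutionPath α (fun t => ε t ω, fun t => η t ω) t := by
  filter_upwards [hsol.σ_pos, hsol.log_σ, hsol.X_eq] with ω h1 h2 h3 t
  have h4 : σ t ω = Real.exp (logVolatility α (fun t => η t ω) t) := by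
    rw [logVolatility, (h2 t).tsum_eq, Real.exp_log (h1 t)]
  simp only [solutionPath, h3 t, ← h4]

/-- Shifting the solution amounts to applying `solutionPath` to shifted innovations, whose joint law
is the same product measure. -/
theorem IsSVSolution.isStrictlyStationary [IsProbabilityMeasure P] [IsProbabilityMeasure με]
    [IsProbabilityMeasure μη] (h : IsInnovationPair P με μη ε η)
    (hsol : IsSVSolution P α ε η X σ) :
    IsStrictlyStationary P (fun t ω => (X t ω, σ t ω)) := by
  intro k
  have hm : Measurable fun ω (t : ℤ) => (X t ω, σ t ω) :=
    measurable_pi_lambda _ fun t => (hsol.measurable_X t).prodMk (hsol.measurable_σ t)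
  have hm' : Measurable fun ω (t : ℤ) => (X (t + k) ω, σ (t + k) ω) :=
    measurable_pi_lambda _ fun t =>
      (hsol.measurable_X (t + k)).prodMk (hsol.measurable_σ (t + k))
  have h1 : (fun ω (t : ℤ) => (X t ω, σ t ω)) =ᵐ[P]
      fun ω => solutionPath α (fun t => ε t ω, fun t => η t ω) := by
    filter_upwards [hsol.ae_eq_solutionPath] with ω hω using funext hω
  have h2 : (fun ω (t : ℤ) => (X (t + k) ω, σ (t + k) ω)) =ᵐ[P]
      fun ω => solutionPath α (fun t => ε (t + k) ω, fun t => η (t + k) ω) := by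
    filter_upwards [hsol.ae_eq_solutionPath] with ω hω
    funext t
    rw [hω (t + k), solutionPath_shift]
  refine ⟨hm'.aemeasurable, hm.aemeasurable, ?_⟩
  rw [Measure.map_congr h1, Measure.map_congr h2]
  have hΦ := measurable_solutionPath α
  have e1 := Measure.map_map (μ := P) hΦ h.measurable_pair
  have e2 := Measure.map_map (μ := P) hΦ (h.shift k).measurable_pair
  rw [h.map_pair] at e1
  rw [(h.shift k).map_pair] at e2
  exact e2.symm.trans e1

theorem exists_isInnovationPair (με μη : Measure ℝ) [IsProbabilityMeasure με]
    [IsProbabilityMeasure μη] :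
    ∃ (Ω : Type) (_ : MeasurableSpace Ω) (P : Measure Ω) (_ : IsProbabilityMeasure P)
      (ε η : ℤ → Ω → ℝ), IsInnovationPair P με μη ε η := by
  set Qε : Measure (ℤ → ℝ) := Measure.infinitePi fun _ => με
  set Qη : Measure (ℤ → ℝ) := Measure.infinitePi fun _ => μη
  have mapε : (Qε.prod Qη).map Prod.fst = Qε := measurePreserving_fst.map_eq
  have mapη : (Qε.prod Qη).map Prod.snd = Qη := measurePreserving_snd.map_eq
  have hlawε : ∀ t, (Qε.prod Qη).map (fun q => q.1 t) = με := fun t => by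
    have := Measure.map_map (μ := Qε.prod Qη) (measurable_pi_apply (X := fun _ : ℤ => ℝ) t)
      measurable_fst
    rw [mapε] at this
    exact this.symm.trans (Measure.infinitePi_map_eval (fun _ => με) t)
  have hlawη : ∀ t, (Qε.prod Qη).map (fun q => q.2 t) = μη := fun t => by
    have := Measure.map_map (μ := Qε.prod Qη) (measurable_pi_apply (X := fun _ : ℤ => ℝ) t)
      measurable_snd
    rw [mapη] at this
    exact this.symm.trans (Measure.infinitePi_map_eval (fun _ => μη) t)
  have hmε : ∀ t : ℤ, Measurable fun q : (ℤ → ℝ) × (ℤ → ℝ) => q.1 t := fun t => by fun_prop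
  have hmη : ∀ t : ℤ, Measurable fun q : (ℤ → ℝ) × (ℤ → ℝ) => q.2 t := fun t => by fun_prop
  refine ⟨(ℤ → ℝ) × (ℤ → ℝ), inferInstance, Qε.prod Qη, inferInstance, fun t q => q.1 t,
    fun t q => q.2 t, hmε, hmη, ?_, ?_, hlawε, hlawη, indepFun_prod measurable_id measurable_id⟩
  · rw [iIndepFun_iff_map_fun_eq_infinitePi_map hmε]
    simp only [hlawε]
    exact mapε
  · rw [iIndepFun_iff_map_fun_eq_infinitePi_map hmη]
    simp only [hlawη]
    exact mapη

/-! ### Tails of the volatility and of the returns -/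

theorem IsInnovationPair.hasRegularlyVaryingTail_exp_logVolatility [IsProbabilityMeasure P]
    [IsProbabilityMeasure μη] (hα : IsSVCoefficient α) (hη : IsGammaTypeLaw μη)
    (h : IsInnovationPair P με μη ε η) :
    HasRegularlyVaryingTail P
      (fun ω => Real.exp (logVolatility α (fun t => η t ω) 0)) (-1) := by
  classical
  obtain ⟨s, hs, hs1, c, hc0, hc1, hc⟩ := hα.exists_gap
  set Y : ℕ → Ω → ℝ := fun i => η (0 - (i : ℤ)) with hY
  have hmY : ∀ i, Measurable (Y i) := fun i => h.measurable_η _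
  have hind : iIndepFun Y P := h.indep_η.precomp
    (g := fun i : ℕ => 0 - (i : ℤ)) fun i j hij => by simpa using hij
  have htail : ∀ i, HasExpTail P (Y i) := fun i =>
    HasExpTail.of_map (hmY i) (by rw [h.law_η]; exact hη.hasExpTail)
  set a : ℕ → ℝ := fun i => if i ∈ s then 0 else α i with ha
  have ha0 : ∀ i, 0 ≤ a i := fun i => by
    simp only [ha]; split_ifs
    · exact le_rfl
    · exact (hα.mem_Icc i).1
  have haα : ∀ i, a i ≤ α i := fun i => by
    simp only [ha]; split_ifs
    · exact (hα.mem_Icc i).1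
    · exact le_rfl
  have hac : ∀ i, a i ≤ c := fun i => by
    simp only [ha]; split_ifs with hi
    · exact hc0.le
    · exact hc i hi
  have hasum : Summable a := hα.summable.of_nonneg_of_le ha0 haα
  have haY : ∀ᵐ ω ∂P, Summable fun i => a i * Y i ω := h.ae_summable hα hη ha0 haα 0
  set S : Ω → ℝ := fun ω => ∑ i ∈ s, Y i ω with hS
  set V : Ω → ℝ := fun ω => ∑' i, a i * Y i ω with hV
  have hmS : Measurable S := Finset.measurable_sum _ fun i _ => hmY i
  have hmV : Measurable V := Measurable.tsum fun i => (hmY i).const_mul _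
  have hSV : IndepFun S V P := hind.indepFun_sum_tsum_mul hmY fun i hi => by simp [ha, hi]
  -- Any `d` in `(c, 1)` works: `p = d / c > 1`, while `p * a i ≤ d < 1` keeps the exponential
  -- moments finite.
  set d : ℝ := (1 + c) / 2 with hd
  set p : ℝ := d / c with hp
  have hd0 : 0 < d := by simp only [hd]; linarith
  have hd1 : d < 1 := by simp only [hd]; linarith
  have hp1 : 1 < p := by rw [hp, one_lt_div hc0]; simp only [hd]; linarith
  have hpint : Integrable (fun ω => Real.exp (V ω) ^ p) P := by
    have hexp : Integrable (fun x => Real.exp (d * x)) μη :=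
      hη.hasExpTail.integrable_exp_mul measurable_id hd0.le hd1
    have hb : ∀ ω, ∑' i, (p * a i) * Y i ω = p * V ω := fun ω => by
      simp only [hV, mul_assoc, tsum_mul_left]
    have := integrable_exp_tsum_mul hind hmY (b := fun i => p * a i) (hasum.mul_left p)
      (fun i => mul_nonneg (by linarith) (ha0 i)) (c := d) (m := ∫ x, Real.exp (d * x) ∂μη) hd0
      (fun i => ?_) (fun i => ?_) (fun i => ?_) ?_
    · refine this.congr (Eventually.of_forall fun ω => ?_)
      simp only [hb, ← Real.exp_mul, mul_comm (V ω)]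
    · calc p * a i ≤ p * c := mul_le_mul_of_nonneg_left (hac i) (by linarith)
        _ = d := div_mul_cancel₀ _ hc0.ne'
    · rw [← h.law_η (0 - i)] at hexp
      exact hexp.comp_measurable (hmY i)
    · rw [← h.law_η (0 - i), integral_map (hmY i).aemeasurable]
      exact (by fun_prop : Measurable fun x : ℝ => Real.exp (d * x)).aestronglyMeasurable
    · filter_upwards [haY] with ω hω
      simpa only [mul_assoc] using hω.mul_left p
  have hmR : Measurable fun ω => Real.exp (V ω) := Real.measurable_exp.comp hmV
  have hRV := (HasExpTail.sum hind hmY htail hs).hasRegularlyVaryingTail_exp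
  have hB := hRV.tendsto_survival_mul_div (Real.measurable_exp.comp hmS) hmR
    (fun ω => (Real.exp_pos _).le) (hSV.comp Real.measurable_exp Real.measurable_exp) hp1 hpint
  refine (hRV.of_tendsto_div (integral_exp_pos
    (hpint.of_rpow hmR (fun ω => (Real.exp_pos _).le) hp1)) hB).congr_ae ?_
  filter_upwards [haY] with ω hω
  rw [← Real.exp_add]
  congr 1
  have hsplit : ∀ i : ℕ, α i * η (0 - (i : ℤ)) ω = (if i ∈ s then Y i ω else 0) + a i * Y i ω := by
    intro i
    by_cases hi : i ∈ s
    · simp [ha, hi, hs1 i hi, hY]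
    · simp [ha, hi, hY]
  have hfin : HasSum (fun i => if i ∈ s then Y i ω else 0) (∑ i ∈ s, Y i ω) := by
    have := hasSum_sum_of_ne_finset_zero (s := s) (f := fun i => if i ∈ s then Y i ω else 0)
      (L := SummationFilter.unconditional ℕ) (fun i hi => if_neg hi)
    rwa [Finset.sum_congr rfl fun i hi => if_pos hi] at this
  rw [logVolatility, tsum_congr hsplit]
  exact (hfin.add hω.hasSum).tsum_eq.symm

theorem IsSVSolution.hasRegularlyVaryingTail_σ [IsProbabilityMeasure P]
    [IsProbabilityMeasure μη] (hα : IsSVCoefficient α) (hη : IsGammaTypeLaw μη)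
    (h : IsInnovationPair P με μη ε η) (hsol : IsSVSolution P α ε η X σ) :
    HasRegularlyVaryingTail P (σ 0) (-1) := by
  refine (h.hasRegularlyVaryingTail_exp_logVolatility hα hη).congr_ae ?_
  filter_upwards [hsol.ae_eq_solutionPath] with ω hω
  exact (congrArg Prod.snd (hω 0)).symm

theorem IsSVSolution.indepFun_σ_ε (h : IsInnovationPair P με μη ε η)
    (hsol : IsSVSolution P α ε η X σ) : IndepFun (σ 0) (ε 0) P := by
  refine (h.indep.symm.comp (Real.measurable_exp.comp (measurable_logVolatility α 0))
    (measurable_pi_apply 0)).congr ?_ EventuallyEq.rfl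
  filter_upwards [hsol.ae_eq_solutionPath] with ω hω
  exact (congrArg Prod.snd (hω 0)).symm

/-- Breiman's lemma with `p = 1 + δ`; the bound `f x ≤ |x|` transfers the moment of `ε 0` to `f (ε
0)`. -/
theorem IsSVSolution.tendsto_survival_mul_div [IsProbabilityMeasure P]
    [IsProbabilityMeasure μη] (hα : IsSVCoefficient α) (hε : IsReturnInnovationLaw με)
    (hη : IsGammaTypeLaw μη) (h : IsInnovationPair P με μη ε η)
    (hsol : IsSVSolution P α ε η X σ) {f : ℝ → ℝ} (hf : Measurable f) (hf0 : ∀ x, 0 ≤ f x)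
    (hfabs : ∀ x, f x ≤ |x|) :
    Tendsto (fun x => P.real {ω | x < σ 0 ω * f (ε 0 ω)} / P.real {ω | x < σ 0 ω}) atTop
      (𝓝 (∫ ω, f (ε 0 ω) ∂P)) := by
  obtain ⟨δ, hδ, hint⟩ := hε.moment
  rw [← h.law_ε 0] at hint
  have hint' := hint.comp_measurable (h.measurable_ε 0)
  have hmf : Measurable fun ω => f (ε 0 ω) := hf.comp (h.measurable_ε 0)
  refine (hsol.hasRegularlyVaryingTail_σ hα hη h).tendsto_survival_mul_div (hsol.measurable_σ 0)
    hmf (fun ω => hf0 _) ((hsol.indepFun_σ_ε h).comp measurable_id hf)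
    (p := 1 + δ) (by linarith) (Integrable.mono' hint' ?_ (Eventually.of_forall fun ω => ?_))
  · exact (hmf.pow_const _).aestronglyMeasurable
  · rw [Real.norm_of_nonneg (Real.rpow_nonneg (hf0 _) _)]
    exact Real.rpow_le_rpow (hf0 _) (hfabs _) (by linarith)

theorem IsInnovationPair.integral_abs_pos [IsProbabilityMeasure P]
    (hε : IsReturnInnovationLaw με) (h : IsInnovationPair P με μη ε η) :
    0 < ∫ ω, |ε 0 ω| ∂P := by
  obtain ⟨δ, hδ, hint⟩ := hε.moment
  rw [← h.law_ε 0] at hint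
  have hint' : Integrable (fun ω => |ε 0 ω|) P :=
    (hint.comp_measurable (h.measurable_ε 0)).of_rpow (h.measurable_ε 0).abs
      (fun ω => abs_nonneg _) (by linarith)
  rw [integral_pos_iff_support_of_nonneg (fun ω => abs_nonneg _) hint']
  have h1 := hε.pos
  rw [← h.law_ε 0, Measure.map_apply (h.measurable_ε 0) measurableSet_Ioi] at h1
  refine h1.trans_le (measure_mono fun ω hω => ?_)
  exact abs_ne_zero.2 (ne_of_gt hω)

end Model

theorem mainTheorem9 (α : ℕ → ℝ) (hα : IsSVCoefficient α)
    (με μη : Measure ℝ) [IsProbabilityMeasure με] [IsProbabilityMeasure μη]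
    (hε : IsReturnInnovationLaw με) (hη : IsGammaTypeLaw μη) :
    -- a stationary model with these parameters exists on some probability space
    (∃ (Ω : Type) (_ : MeasurableSpace Ω) (P : Measure Ω) (_ : IsProbabilityMeasure P)
      (ε η X σ : ℤ → Ω → ℝ),
      IsInnovationPair P με μη ε η ∧ IsSVSolution P α ε η X σ ∧
      IsStrictlyStationary P (fun t ω => (X t ω, σ t ω))) ∧
    -- for any given innovations a solution exists, and every solution is stationary and has
    -- the stated tails
    (∀ (Ω : Type u) [MeasurableSpace Ω] (P : Measure Ω) [IsProbabilityMeasure P]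
      (ε η : ℤ → Ω → ℝ), IsInnovationPair P με μη ε η →
      (∃ X σ : ℤ → Ω → ℝ, IsSVSolution P α ε η X σ) ∧
      ∀ X σ : ℤ → Ω → ℝ, IsSVSolution P α ε η X σ →
        IsStrictlyStationary P (fun t ω => (X t ω, σ t ω)) ∧
        HasRegularlyVaryingTail P (fun ω => |X 0 ω|) (-1) ∧
        HasRegularlyVaryingTail P (σ 0) (-1) ∧
        Tendsto (fun x : ℝ => P.real {ω | x < X 0 ω} / P.real {ω | x < |X 0 ω|}) atTop
          (𝓝 ((∫ ω, max (ε 0 ω) 0 ∂P) / ∫ ω, |ε 0 ω| ∂P)) ∧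
        Tendsto (fun x : ℝ => P.real {ω | X 0 ω < -x} / P.real {ω | x < |X 0 ω|}) atTop
          (𝓝 ((∫ ω, max (-ε 0 ω) 0 ∂P) / ∫ ω, |ε 0 ω| ∂P)) ∧
        Tendsto (fun x : ℝ => P.real {ω | x < |X 0 ω|} / P.real {ω | x < σ 0 ω}) atTop
          (𝓝 (∫ ω, |ε 0 ω| ∂P)) ∧
        Tendsto (fun x : ℝ => P.real {ω | x < X 0 ω} / P.real {ω | x < σ 0 ω}) atTop
          (𝓝 (∫ ω, max (ε 0 ω) 0 ∂P))) := by
  refine ⟨?_, fun Ω _ P _ ε η h => ⟨h.exists_solution hα hη, fun X σ hsol => ?_⟩⟩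
  · obtain ⟨Ω, _, P, _, ε, η, h⟩ := exists_isInnovationPair με μη
    obtain ⟨X, σ, hsol⟩ := h.exists_solution hα hη
    exact ⟨Ω, _, P, inferInstance, ε, η, X, σ, h, hsol, hsol.isStrictlyStationary h⟩
  have hσ := hsol.hasRegularlyVaryingTail_σ hα hη h
  have hpos := h.integral_abs_pos hε
  have habs := hsol.tendsto_survival_mul_div hα hε hη h (f := fun x => |x|)
    continuous_abs.measurable abs_nonneg fun _ => le_rfl
  have hplus := hsol.tendsto_survival_mul_div hα hε hη h (f := fun x => max x 0)
    (measurable_id.max measurable_const) (fun _ => le_max_right _ _)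
    fun x => max_le (le_abs_self x) (abs_nonneg x)
  have hminus := hsol.tendsto_survival_mul_div hα hε hη h (f := fun x => max (-x) 0)
    (measurable_neg.max measurable_const) (fun _ => le_max_right _ _)
    fun x => max_le (neg_le_abs x) (abs_nonneg x)
  have hae : ∀ᵐ ω ∂P, 0 < σ 0 ω ∧ X 0 ω = σ 0 ω * ε 0 ω := by
    filter_upwards [hsol.σ_pos, hsol.X_eq] with ω h1 h2 using ⟨h1 0, h2 0⟩
  have eabs : ∀ x, P.real {ω | x < σ 0 ω * |ε 0 ω|} = P.real {ω | x < |X 0 ω|} := fun x => by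
    refine measureReal_congr ?_
    filter_upwards [hae] with ω ⟨h1, h2⟩
    refine propext ?_
    change x < _ ↔ x < _
    rw [h2, abs_mul, abs_of_pos h1]
  -- Truncation at zero is invisible above a level `x > 0`.
  have eplus : ∀ x, 0 < x →
      P.real {ω | x < σ 0 ω * max (ε 0 ω) 0} = P.real {ω | x < X 0 ω} := fun x hx => by
    refine measureReal_congr ?_
    filter_upwards [hae] with ω ⟨h1, h2⟩
    refine propext ?_
    change x < _ ↔ x < _
    rw [h2, mul_max_of_nonneg _ _ h1.le, mul_zero, lt_max_iff, or_iff_left hx.not_gt]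
  have eminus : ∀ x, 0 < x →
      P.real {ω | x < σ 0 ω * max (-ε 0 ω) 0} = P.real {ω | X 0 ω < -x} := fun x hx => by
    refine measureReal_congr ?_
    filter_upwards [hae] with ω ⟨h1, h2⟩
    refine propext ?_
    change x < _ ↔ _ < -x
    rw [h2, mul_max_of_nonneg _ _ h1.le, mul_zero, lt_max_iff, or_iff_left hx.not_gt, mul_neg,
      lt_neg]
  simp only [eabs] at habs
  have hratio : ∀ {g : ℝ → ℝ} {m : ℝ},
      Tendsto (fun x => g x / P.real {ω | x < σ 0 ω}) atTop (𝓝 m) →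
      Tendsto (fun x => g x / P.real {ω | x < |X 0 ω|}) atTop (𝓝 (m / ∫ ω, |ε 0 ω| ∂P)) := by
    intro g m hg
    refine (hg.div habs hpos.ne').congr fun x => ?_
    exact div_div_div_cancel_right₀ (hσ.pos x).ne' _ _
  have hplus' : Tendsto (fun x : ℝ => P.real {ω | x < X 0 ω} / P.real {ω | x < σ 0 ω}) atTop
      (𝓝 (∫ ω, max (ε 0 ω) 0 ∂P)) := by
    refine hplus.congr' ?_
    filter_upwards [eventually_gt_atTop 0] with x hx using by rw [eplus x hx]
  have hminus' : Tendsto (fun x : ℝ => P.real {ω | X 0 ω < -x} / P.real {ω | x < σ 0 ω}) atTop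
      (𝓝 (∫ ω, max (-ε 0 ω) 0 ∂P)) := by
    refine hminus.congr' ?_
    filter_upwards [eventually_gt_atTop 0] with x hx using by rw [eminus x hx]
  exact ⟨hsol.isStrictlyStationary h, hσ.of_tendsto_div hpos habs, hσ, hratio hplus',
    hratio hminus', habs, hplus'⟩
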